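/- There are absolute constants $c>0$ and $C>0$ such that the following holds. Let $d$ be a positive integer and let $\varepsilon$ be a real number with $2^{-d/3}<\varepsilon<1/170$. Then there are two probability distributions $P_1,P_2$ on $\{-1,1\}^d$, viewed as functions $P_b:\{-1,1\}^d\to[0,\infty)$ with $\sum_x P_b(x)=1$, with the following properties. (1) For every $S\subseteq\{1,\dots,d\}$ with $|S|\le c\sqrt{d/\log(1/\varepsilon)}$, $$\bigl|\widehat{P_1}(S)-\widehat{P_2}(S)\bigr|\le 2^{-d}\cdot 2^{-C\sqrt{d\log(1/\varepsilon)}},$$ where $\log$ is the natural logarithm and $\widehat P(S)=2^{-d}\sum_{x\in\{-1,1\}^d}P(x)\prod_{i\in S}x_i$ is the $S$-th Walsh–Fourier coefficient of $P$. (2) $|P_1(1^d)-P_2(1^d)|\ge 2\varepsilon$, where $1^d=(1,\dots,1)$. -/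

import Mathlib

open scoped BigOperators

/-- The discrete cube `{-1, 1}^d`, where `{-1, 1}` is the group of units of the integers. -/
abbrev SignCube (d : ℕ) : Type := Fin d → ℤˣ

/-- The point `1^d`, all of whose coordinates are `1`. -/
def allOnes (d : ℕ) : SignCube d := fun _ => 1

/-- The Walsh character `χ_S(x) = ∏_{i ∈ S} x_i`, as a real-valued function on the cube. -/
def walshChar {d : ℕ} (S : Finset (Fin d)) (x : SignCube d) : ℝ :=
  ∏ i ∈ S, ((x i : ℤ) : ℝ)

/-- The `S`-th Walsh–Fourier coefficient `E_x [P(x) χ_S(x)]`, where `x` is uniform on the cube. -/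
noncomputable def walshCoeff {d : ℕ} (P : SignCube d → ℝ) (S : Finset (Fin d)) : ℝ :=
  𝔼 x : SignCube d, P x * walshChar S x

open Finset Polynomial

/-! ### Signed functions of total mass zero as differences of distributions -/

/-! The low-degree coefficients can be made exactly equal, with a constant gap at `1^d`. Under the
product distribution of bias `1 - 32t/d`, the mean of `χ_S` is a polynomial in `t` of degree at most
`|S|`, while the mass at `1^d` is 1 for `t = 0` and at most `1/5` once `t ≥ 1/4`. A signed measure
in `t` that kills degrees up to `N ≈ √d/4` but keeps a constant share of its mass at 0
(`sum_squareWeight_mul_eval`, `sum_abs_squareWeight_le`) thus mixes these distributions into the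
required difference. -/

lemma exists_stdSimplex_sub_eq {α : Type*} [Fintype α] [Nonempty α] (f : α → ℝ)
    (hsum : ∑ x, f x = 0) (habs : ∑ x, |f x| ≤ 2) :
    ∃ P ∈ stdSimplex ℝ α, ∃ Q ∈ stdSimplex ℝ α, ∀ x, P x - Q x = f x := by
  classical
  obtain ⟨a⟩ := ‹Nonempty α›
  have hpos : ∑ x, (f x)⁺ = (∑ x, |f x|) / 2 := by
    have h : ∀ x, (f x)⁺ = (|f x| + f x) / 2 := fun x ↦ by
      linarith [posPart_add_negPart (f x), posPart_sub_negPart (f x)]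
    simp_rw [h]
    rw [← Finset.sum_div, Finset.sum_add_distrib, hsum, add_zero]
  have hneg : ∑ x, (f x)⁻ = (∑ x, |f x|) / 2 := by
    rw [← hpos, ← sub_eq_zero, ← Finset.sum_sub_distrib, ← neg_eq_zero, ← Finset.sum_neg_distrib,
      ← hsum]
    exact Finset.sum_congr rfl fun x _ ↦ by linarith [posPart_sub_negPart (f x)]
  -- The mass missing from both parts is added at the same point `a`, so it cancels in the
  -- difference.
  have hrest : 0 ≤ 1 - (∑ x, |f x|) / 2 := by linarith
  have hsingle : ∀ x, 0 ≤ Pi.single (M := fun _ ↦ ℝ) a (1 - (∑ x, |f x|) / 2) x :=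
    fun x ↦ (Pi.single_nonneg.2 hrest : (0 : α → ℝ) ≤ _) x
  refine ⟨fun x ↦ (f x)⁺ + Pi.single (M := fun _ ↦ ℝ) a (1 - (∑ x, |f x|) / 2) x,
    ⟨fun x ↦ add_nonneg (posPart_nonneg _) (hsingle x), ?_⟩,
    fun x ↦ (f x)⁻ + Pi.single (M := fun _ ↦ ℝ) a (1 - (∑ x, |f x|) / 2) x,
    ⟨fun x ↦ add_nonneg (negPart_nonneg _) (hsingle x), ?_⟩, fun x ↦ ?_⟩
  · rw [Finset.sum_add_distrib, hpos, Finset.sum_pi_single']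
    simp
  · rw [Finset.sum_add_distrib, hneg, Finset.sum_pi_single']
    simp
  · linarith [posPart_sub_negPart (f x)]

/-! ### Product distributions of a given bias -/

/-- The distribution on the cube under which the coordinates are independent of mean `r`. -/
noncomputable def biasedDist (d : ℕ) (r : ℝ) (x : SignCube d) : ℝ :=
  ∏ i, (1 + r * ((x i : ℤ) : ℝ)) / 2

lemma sum_biasedDist_mul_walshChar {d : ℕ} (r : ℝ) (S : Finset (Fin d)) :
    ∑ x, biasedDist d r x * walshChar S x = r ^ S.card := by
  have h : ∀ x : SignCube d, biasedDist d r x * walshChar S x =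
      ∏ i, ((1 + r * ((x i : ℤ) : ℝ)) / 2 * if i ∈ S then ((x i : ℤ) : ℝ) else 1) := fun x ↦ by
    rw [biasedDist, walshChar, Finset.prod_mul_distrib, Finset.prod_ite_mem, Finset.univ_inter]
  have h' := Finset.prod_univ_sum (fun _ : Fin d ↦ (Finset.univ : Finset ℤˣ))
    (fun i u ↦ (1 + r * ((u : ℤ) : ℝ)) / 2 * if i ∈ S then ((u : ℤ) : ℝ) else 1)
  rw [Fintype.piFinset_univ] at h'
  simp_rw [h]
  rw [← h', ← Finset.prod_const, ← Finset.univ_inter S, ← Finset.prod_ite_mem, Finset.univ_inter]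
  refine Finset.prod_congr rfl fun i _ ↦ ?_
  rw [UnitsInt.univ, Finset.sum_pair (by decide)]
  split_ifs <;> push_cast <;> ring

lemma sum_biasedDist {d : ℕ} (r : ℝ) : ∑ x, biasedDist d r x = 1 := by
  simpa [walshChar] using sum_biasedDist_mul_walshChar (d := d) r ∅

lemma biasedDist_nonneg {d : ℕ} {r : ℝ} (hr : |r| ≤ 1) (x : SignCube d) :
    0 ≤ biasedDist d r x := by
  refine Finset.prod_nonneg fun i _ ↦ ?_
  obtain ⟨h₁, h₂⟩ := abs_le.1 hr
  rcases Int.units_eq_one_or (x i) with h | h <;> rw [h] <;> push_cast <;> linarith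

lemma biasedDist_allOnes (d : ℕ) (r : ℝ) : biasedDist d r (allOnes d) = ((1 + r) / 2) ^ d := by
  simp [biasedDist, allOnes, div_pow]

lemma one_sub_div_pow_le_inv_one_add {n : ℕ} {y : ℝ} (hy : 0 ≤ y) (hyn : y ≤ n) :
    (1 - y / n) ^ n ≤ (1 + y)⁻¹ := by
  refine (Real.one_sub_div_pow_le_exp_neg hyn).trans ?_
  rw [Real.exp_neg]
  exact inv_anti₀ (by linarith) (by linarith [Real.add_one_le_exp y])

/-! ### A signed measure on squares which is almost concentrated at zero -/

/-- The weight at the node `(k - N) ^ 2`, to be balanced by a mass at the node `1 / 4`. -/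
noncomputable def squareWeight (N k : ℕ) : ℝ :=
  (-1) ^ (2 * N - k) * ((2 * N).choose k / (2 * N).choose N) / (((k : ℝ) - N) ^ 2 - 1 / 4)

lemma one_le_sq_sub {N k : ℕ} (hk : k ≠ N) : 1 ≤ ((k : ℝ) - N) ^ 2 := by
  have h : 1 ≤ |(k : ℤ) - N| := Int.one_le_abs (by omega)
  have h' : (1 : ℝ) ≤ |(k : ℝ) - N| := by exact_mod_cast h
  rw [← sq_abs]
  nlinarith

lemma sq_sub_ne_quarter (N k : ℕ) : ((k : ℝ) - N) ^ 2 - 1 / 4 ≠ 0 := by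
  rcases eq_or_ne k N with rfl | hk
  · norm_num
  · linarith [one_le_sq_sub hk]

/-- Writing `P(t) - P(1/4) = (t - 1/4) Q(t)` cancels the denominators of the weights, leaving a
multiple of the `2N`-th difference of `Q(x²)`, whose degree is below `2N`. -/
lemma sum_squareWeight_mul_eval {N : ℕ} (hN : 1 ≤ N) (P : ℝ[X]) (hP : P.natDegree ≤ N) :
    ∑ k ∈ range (2 * N + 1), squareWeight N k * P.eval (((k : ℝ) - N) ^ 2) =
      (∑ k ∈ range (2 * N + 1), squareWeight N k) * P.eval (1 / 4) := by
  set Q := P /ₘ (X - C (1 / 4 : ℝ)) with hQ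
  have hPQ : ∀ t, P.eval t - P.eval (1 / 4) = (t - 1 / 4) * Q.eval t := fun t ↦ by
    have h := congrArg (eval t) (modByMonic_add_div P (X - C (1 / 4 : ℝ)))
    rw [modByMonic_X_sub_C_eq_C_eval] at h
    simp only [eval_add, eval_mul, eval_sub, eval_X, eval_C] at h
    linarith
  have hdeg : (Q.comp (X ^ 2)).natDegree < 2 * N := by
    rw [natDegree_comp, natDegree_X_pow, hQ, natDegree_divByMonic _ (monic_X_sub_C _),
      natDegree_X_sub_C]
    omega
  have hdiff := congrFun (Polynomial.fwdDiff_iter_eq_zero_of_degree_lt hdeg) (-(N : ℝ))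
  rw [fwdDiff_iter_eq_sum_shift] at hdiff
  rw [Finset.sum_mul, ← sub_eq_zero, ← Finset.sum_sub_distrib]
  calc _ = ∑ k ∈ range (2 * N + 1), ((-1 : ℤ) ^ (2 * N - k) * ((2 * N).choose k : ℤ)) •
          (Q.comp (X ^ 2)).eval (-(N : ℝ) + k • (1 : ℝ)) / ((2 * N).choose N : ℝ) := by
        refine Finset.sum_congr rfl fun k _ ↦ ?_
        rw [← mul_sub, hPQ, squareWeight, eval_comp, eval_pow, eval_X, nsmul_one, neg_add_eq_sub,
          zsmul_eq_mul]
        push_cast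
        rw [← mul_assoc, div_mul_cancel₀ _ (sq_sub_ne_quarter N k)]
        ring
    _ = 0 := by rw [← Finset.sum_div, hdiff, Pi.zero_apply, zero_div]

lemma abs_squareWeight_self (N : ℕ) : |squareWeight N N| = 4 := by
  have h : ((2 * N).choose N : ℝ) ≠ 0 :=
    Nat.cast_ne_zero.2 (Nat.choose_pos (by omega)).ne'
  rw [squareWeight, div_self h, abs_div, mul_one, abs_pow, abs_neg, abs_one, one_pow, sub_self]
  norm_num [abs_of_neg]

lemma abs_squareWeight_le {N k : ℕ} (hk : k ≠ N) :
    |squareWeight N k| ≤ 1 / (((k : ℝ) - N) ^ 2 - 1 / 4) := by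
  have hpos : 0 < ((2 * N).choose N : ℝ) := Nat.cast_pos.2 (Nat.choose_pos (by omega))
  have hle : ((2 * N).choose k : ℝ) ≤ (2 * N).choose N :=
    Nat.cast_le.2 (Nat.choose_le_centralBinom k N)
  have hq : 0 < ((k : ℝ) - N) ^ 2 - 1 / 4 := by linarith [one_le_sq_sub hk]
  rw [squareWeight, abs_div, abs_mul, abs_pow, abs_neg, abs_one, one_pow, one_mul,
    abs_of_pos hq, abs_of_nonneg (by positivity)]
  gcongr
  exact (div_le_one hpos).2 hle

/-- Partial fractions telescope. As the term `k = N` is `-4`, the others total less than 4: this is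
what the extra node `1/4` buys. -/
lemma sum_inv_sq_sub_quarter (N : ℕ) :
    ∑ k ∈ range (2 * N + 1), 1 / (((k : ℝ) - N) ^ 2 - 1 / 4) = -(4 / (2 * N + 1) : ℝ) := by
  have h : ∀ k : ℕ, 1 / (((k : ℝ) - N) ^ 2 - 1 / 4) =
      1 / ((k : ℝ) - N - 1 / 2) - 1 / (((k + 1 : ℕ) : ℝ) - N - 1 / 2) := fun k ↦ by
    have hk := sq_sub_ne_quarter N k
    have h₁ : (k : ℝ) - N - 1 / 2 ≠ 0 := fun h ↦ hk (by linear_combination (k - N + 1 / 2 : ℝ) * h)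
    have h₂ : ((k + 1 : ℕ) : ℝ) - N - 1 / 2 ≠ 0 := fun h ↦ hk (by
      push_cast at h
      linear_combination (k - N - 1 / 2 : ℝ) * h)
    rw [div_sub_div _ _ h₁ h₂, div_eq_div_iff hk (mul_ne_zero h₁ h₂)]
    push_cast
    ring
  simp_rw [h]
  rw [Finset.sum_range_sub' (fun k : ℕ ↦ 1 / ((k : ℝ) - N - 1 / 2))]
  have h₀ : (2 * N + 1 : ℝ) ≠ 0 := by positivity
  have h₁ : ((0 : ℕ) : ℝ) - N - 1 / 2 = -((2 * N + 1) / 2) := by push_cast; ring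
  have h₂ : ((2 * N + 1 : ℕ) : ℝ) - N - 1 / 2 = (2 * N + 1) / 2 := by push_cast; ring
  rw [h₁, h₂]
  field_simp
  ring

lemma sum_erase_abs_squareWeight_le (N : ℕ) :
    ∑ k ∈ (range (2 * N + 1)).erase N, |squareWeight N k| ≤ 4 := by
  have hN : N ∈ range (2 * N + 1) := Finset.mem_range.2 (by omega)
  have h := Finset.add_sum_erase _ (fun k : ℕ ↦ 1 / (((k : ℝ) - N) ^ 2 - 1 / 4)) hN
  rw [sum_inv_sq_sub_quarter] at h
  have h₀ : 1 / (((N : ℝ) - N) ^ 2 - 1 / 4) = -4 := by norm_num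
  have h₁ : 0 ≤ 4 / (2 * (N : ℝ) + 1) := by positivity
  have h₂ := Finset.sum_le_sum fun k (hk : k ∈ (range (2 * N + 1)).erase N) ↦
    abs_squareWeight_le (Finset.ne_of_mem_erase hk)
  simp only [h₀] at h
  linarith

lemma sum_abs_squareWeight_le (N : ℕ) : ∑ k ∈ range (2 * N + 1), |squareWeight N k| ≤ 8 := by
  have hN : N ∈ range (2 * N + 1) := Finset.mem_range.2 (by omega)
  rw [← Finset.add_sum_erase _ _ hN, abs_squareWeight_self]
  linarith [sum_erase_abs_squareWeight_le N]

/-! ### Low-degree indistinguishable distributions on the cube -/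

lemma exists_walshCoeff_eq {d N : ℕ} (hN : 1 ≤ N) (hd : 16 * N ^ 2 ≤ d) :
    ∃ P₁ ∈ stdSimplex ℝ (SignCube d), ∃ P₂ ∈ stdSimplex ℝ (SignCube d),
      (∀ S : Finset (Fin d), S.card ≤ N → walshCoeff P₁ S = walshCoeff P₂ S) ∧
      1 / 5 ≤ |P₁ (allOnes d) - P₂ (allOnes d)| := by
  have hN' : (1 : ℝ) ≤ N := by exact_mod_cast hN
  have hd' : 16 * (N : ℝ) ^ 2 ≤ d := by exact_mod_cast hd
  have hd₀ : (0 : ℝ) < d := by nlinarith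
  set W := ∑ k ∈ range (2 * N + 1), squareWeight N k
  have hW8 : |W| ≤ 8 := (Finset.abs_sum_le_sum_abs _ _).trans (sum_abs_squareWeight_le N)
  -- The bias stays in `[-1, 1]` because `t ≤ N²` and `16N² ≤ d`.
  set D : ℝ → SignCube d → ℝ := fun t ↦ biasedDist d (1 - 32 * t / d) with hD
  have hDnonneg : ∀ t, 0 ≤ t → t ≤ (N : ℝ) ^ 2 → ∀ x, 0 ≤ D t x := fun t h₀ h₁ ↦
    biasedDist_nonneg <| by
      have h₂ : 32 * t / d ≤ 2 := (div_le_iff₀ hd₀).2 (by linarith)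
      have h₃ : 0 ≤ 32 * t / d := by positivity
      exact abs_le.2 ⟨by linarith, by linarith⟩
  have hDsum : ∀ t, ∑ x, D t x = 1 := fun t ↦ sum_biasedDist _
  have hDone : ∀ t, 1 / 4 ≤ t → t ≤ (N : ℝ) ^ 2 → |D t (allOnes d)| ≤ 1 / 5 := fun t h₀ h₁ ↦ by
    have h : D t (allOnes d) = (1 - 16 * t / d) ^ d := by
      simp only [hD, biasedDist_allOnes]; ring
    rw [abs_of_nonneg (hDnonneg t (by linarith) h₁ _), h]
    refine (one_sub_div_pow_le_inv_one_add (by linarith) (by linarith)).trans ?_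
    rw [one_div]
    exact inv_anti₀ (by norm_num) (by linarith)
  have hnode : ∀ k ∈ range (2 * N + 1), ((k : ℝ) - N) ^ 2 ≤ (N : ℝ) ^ 2 := fun k hk ↦ by
    have h : (k : ℝ) ≤ 2 * N := by exact_mod_cast Nat.lt_succ_iff.1 (Finset.mem_range.1 hk)
    have h' : (0 : ℝ) ≤ k := k.cast_nonneg
    nlinarith
  have hquarter : (1 / 4 : ℝ) ≤ (N : ℝ) ^ 2 := by nlinarith
  -- Dividing by 8 brings the total mass `8 + |W| ≤ 16` down to 2.
  set f : SignCube d → ℝ := fun x ↦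
    (∑ k ∈ range (2 * N + 1), squareWeight N k * D (((k : ℝ) - N) ^ 2) x - W * D (1 / 4) x) / 8
    with hf
  have hfS : ∀ S : Finset (Fin d), S.card ≤ N → ∑ x, f x * walshChar S x = 0 := fun S hS ↦ by
    have hpoly := sum_squareWeight_mul_eval hN ((1 - C (32 / (d : ℝ)) * X) ^ S.card)
      (by
        have h : (1 - C (32 / (d : ℝ)) * X : ℝ[X]).natDegree ≤ 1 := by compute_degree
        exact (natDegree_pow_le_of_le S.card h).trans (by omega))
    have hmoment : ∀ t, ∑ x, D t x * walshChar S x =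
        ((1 - C (32 / (d : ℝ)) * X) ^ S.card : ℝ[X]).eval t := fun t ↦ by
      rw [hD, sum_biasedDist_mul_walshChar]
      simp only [eval_pow, eval_sub, eval_one, eval_mul, eval_C, eval_X]
      ring
    have h : ∀ x, f x * walshChar S x =
        (∑ k ∈ range (2 * N + 1), squareWeight N k * (D (((k : ℝ) - N) ^ 2) x * walshChar S x) -
          W * (D (1 / 4) x * walshChar S x)) / 8 := fun x ↦ by
      simp only [hf, ← mul_assoc, ← Finset.sum_mul]
      ring
    simp_rw [h]
    rw [← Finset.sum_div, Finset.sum_sub_distrib, Finset.sum_comm]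
    simp_rw [← Finset.mul_sum, hmoment]
    rw [hpoly, sub_self, zero_div]
  have hfsum : ∑ x, f x = 0 := by simpa [walshChar] using hfS ∅ (by simp)
  have hfabs : ∑ x, |f x| ≤ 2 := by
    have h : ∀ x, |f x| ≤ (∑ k ∈ range (2 * N + 1),
        |squareWeight N k| * D (((k : ℝ) - N) ^ 2) x + |W| * D (1 / 4) x) / 8 := fun x ↦ by
      rw [hf, abs_div, abs_of_pos (by norm_num : (0 : ℝ) < 8)]
      gcongr
      refine (abs_sub _ _).trans (add_le_add ((Finset.abs_sum_le_sum_abs _ _).trans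
        (Finset.sum_le_sum fun k hk ↦ ?_)) ?_)
      · rw [abs_mul, abs_of_nonneg (hDnonneg _ (sq_nonneg _) (hnode k hk) x)]
      · rw [abs_mul, abs_of_nonneg (hDnonneg _ (by norm_num) hquarter x)]
    refine (Finset.sum_le_sum fun x _ ↦ h x).trans ?_
    rw [← Finset.sum_div, Finset.sum_add_distrib, Finset.sum_comm]
    simp_rw [← Finset.mul_sum, hDsum, mul_one]
    linarith [sum_abs_squareWeight_le N]
  -- The node 0 contributes 4, the other squares at most `4/5`, the node `1/4` at most `8/5`; then
  -- `(4 - 4/5 - 8/5)/8 = 1/5`.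
  have hfone : 1 / 5 ≤ |f (allOnes d)| := by
    have hN_mem : N ∈ range (2 * N + 1) := Finset.mem_range.2 (by omega)
    have hD0 : D (((N : ℝ) - N) ^ 2) (allOnes d) = 1 := by
      simp only [hD, biasedDist_allOnes]; norm_num
    have hrest : |∑ k ∈ (range (2 * N + 1)).erase N,
        squareWeight N k * D (((k : ℝ) - N) ^ 2) (allOnes d)| ≤ 4 / 5 := by
      calc _ ≤ ∑ k ∈ (range (2 * N + 1)).erase N, |squareWeight N k| * (1 / 5) := by
            refine (Finset.abs_sum_le_sum_abs _ _).trans (Finset.sum_le_sum fun k hk ↦ ?_)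
            obtain ⟨hkN, hk⟩ := Finset.mem_erase.1 hk
            rw [abs_mul]
            gcongr
            exact hDone _ (by linarith [one_le_sq_sub hkN]) (hnode k hk)
        _ ≤ 4 / 5 := by
            rw [← Finset.sum_mul]
            linarith [sum_erase_abs_squareWeight_le N]
    have hWone : |W * D (1 / 4) (allOnes d)| ≤ 8 / 5 := by
      rw [abs_mul]
      calc _ ≤ 8 * (1 / 5 : ℝ) := by gcongr; exact hDone _ le_rfl hquarter
        _ = 8 / 5 := by norm_num
    rw [hf, abs_div, abs_of_pos (by norm_num : (0 : ℝ) < 8), le_div_iff₀ (by norm_num)]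
    rw [← Finset.add_sum_erase _ _ hN_mem, hD0, mul_one, add_sub_assoc]
    refine le_trans ?_ (abs_sub_abs_le_abs_add _ _)
    rw [abs_squareWeight_self]
    linarith [(abs_sub (∑ k ∈ (range (2 * N + 1)).erase N,
      squareWeight N k * D (((k : ℝ) - N) ^ 2) (allOnes d)) (W * D (1 / 4) (allOnes d)))]
  have : Nonempty (SignCube d) := ⟨allOnes d⟩
  obtain ⟨P₁, hP₁, P₂, hP₂, hsub⟩ := exists_stdSimplex_sub_eq f hfsum hfabs
  refine ⟨P₁, hP₁, P₂, hP₂, fun S hS ↦ ?_, by rwa [hsub]⟩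
  rw [← sub_eq_zero, walshCoeff, walshCoeff, ← Finset.expect_sub_distrib]
  simp_rw [← sub_mul, hsub]
  rw [Finset.expect_eq_sum_div_card, hfS S hS, zero_div]

theorem theorem6p2 :
    ∃ c : ℝ, 0 < c ∧ ∃ C : ℝ, 0 < C ∧
      ∀ (d : ℕ) (ε : ℝ), (2 : ℝ) ^ (-((d : ℝ) / 3)) < ε → ε < 1 / 170 →
        ∃ P₁ ∈ stdSimplex ℝ (SignCube d), ∃ P₂ ∈ stdSimplex ℝ (SignCube d),
          (∀ S : Finset (Fin d), (S.card : ℝ) ≤ c * √((d : ℝ) / Real.log (1 / ε)) →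
            |walshCoeff P₁ S - walshCoeff P₂ S| ≤
              (2 : ℝ) ^ (-(d : ℝ)) * (2 : ℝ) ^ (-(C * √((d : ℝ) * Real.log (1 / ε))))) ∧
          2 * ε ≤ |P₁ (allOnes d) - P₂ (allOnes d)| := by
  -- `1/4` matches `N = ⌊√(d/16)⌋`, since `log (1/ε) ≥ 1`; any `C` would do, the coefficients being
  -- equal.
  refine ⟨1 / 4, by norm_num, 1, one_pos, fun d ε hε hε' ↦ ?_⟩
  have hε₀ : 0 < ε := (Real.rpow_pos_of_pos two_pos _).trans hε
  have hd : 16 ≤ d := by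
    by_contra! h
    have h₁ : (2 : ℝ) ^ (-(5 : ℝ)) ≤ 2 ^ (-((d : ℝ) / 3)) := by
      refine Real.rpow_le_rpow_of_exponent_le one_le_two ?_
      have h₂ : (d : ℝ) ≤ 15 := by exact_mod_cast Nat.lt_succ_iff.1 h
      linarith
    have h₃ : (2 : ℝ) ^ (-(5 : ℝ)) = 1 / 32 := by
      rw [Real.rpow_neg two_pos.le]
      norm_num
    linarith
  have hlog : 1 ≤ Real.log (1 / ε) := by
    rw [Real.le_log_iff_exp_le (by positivity), le_div_iff₀ hε₀]
    nlinarith [Real.exp_one_lt_d9, Real.exp_pos 1]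
  have hN : 1 ≤ Nat.sqrt (d / 16) := Nat.le_sqrt.2 (by omega)
  have hN' : 16 * Nat.sqrt (d / 16) ^ 2 ≤ d := by
    have := Nat.sqrt_le' (d / 16)
    omega
  obtain ⟨P₁, hP₁, P₂, hP₂, hcoeff, hone⟩ := exists_walshCoeff_eq hN hN'
  refine ⟨P₁, hP₁, P₂, hP₂, fun S hS ↦ ?_, by linarith⟩
  rw [hcoeff S, sub_self, abs_zero]
  · positivity
  · have h₁ : (S.card : ℝ) ≤ 1 / 4 * √(d : ℝ) := hS.trans <| by
      gcongr
      exact div_le_self d.cast_nonneg hlog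
    have h₂ : (S.card : ℝ) ^ 2 * 16 ≤ d := by
      nlinarith [Real.sq_sqrt (Nat.cast_nonneg (α := ℝ) d), Real.sqrt_nonneg (d : ℝ),
        Nat.cast_nonneg (α := ℝ) S.card]
    rw [Nat.le_sqrt', Nat.le_div_iff_mul_le (by norm_num)]
    exact_mod_cast h₂
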